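/- Rings are associative but not necessarily unital. Let $R$ be a ring and let $R\text{-}{}^n\mathrm{Mod}$ be the abelian category of nonunital left $R$-modules (equivalently, unital left modules over $\widetilde R=\mathbb Z\oplus R$). For a left $R$-module $M$, let $R\otimes_R M$ be the quotient of $R\otimes_{\mathbb Z}M$ by the subgroup generated by the elements $rs\otimes m-r\otimes sm$, with $R$ acting through the left factor, and let $\operatorname{Hom}_R(R,M)$ be the group of left $R$-module maps $R\to M$ with the action $(rf)(s)=f(sr)$. There are natural $R$-module maps $\mu_M\colon R\otimes_R M\to M$, $r\otimes m\mapsto rm$, and $\nu_M\colon M\to\operatorname{Hom}_R(R,M)$, $m\mapsto(r\mapsto rm)$. The module $M$ is t-unital if $\mu_M$ is an isomorphism, c-unital if $\nu_M$ is an isomorphism, and a null-module if $rm=0$ for all $r\in R$, $m\in M$. Let $R\text{-}{}^t\mathrm{Mod}$, $R\text{-}{}^c\mathrm{Mod}$, $R\text{-}{}^0\mathrm{Mod}$ be the full subcategories of $R\text{-}{}^n\mathrm{Mod}$ formed by the t-unital, the c-unital and the null-modules. The ring $R$ is t-unital if the multiplication map $R\otimes_R R\to R$ is an isomorphism. **Corollary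 5.10.** Let $R$ be a t-unital ring. Then $R\text{-}{}^0\mathrm{Mod}$ is a Serre subcategory of $R\text{-}{}^n\mathrm{Mod}$, the module $R\otimes_R M$ is t-unital and the module $\operatorname{Hom}_R(R,M)$ is c-unital for every left $R$-module $M$, the categories $R\text{-}{}^t\mathrm{Mod}$, $R\text{-}{}^n\mathrm{Mod}/R\text{-}{}^0\mathrm{Mod}$ and $R\text{-}{}^c\mathrm{Mod}$ are abelian, and there are additive equivalences $$R\text{-}{}^t\mathrm{Mod}\;\simeq\;R\text{-}{}^n\mathrm{Mod}/R\text{-}{}^0\mathrm{Mod}\;\simeq\;R\text{-}{}^c\mathrm{Mod}.$$ Here the functors from $R\text{-}{}^t\mathrm{Mod}$ and from $R\text{-}{}^c\mathrm{Mod}$ to the Serre quotient are the compositions of the inclusion into $R\text{-}{}^n\mathrm{Mod}$ with the localization functor, and their quasi-inverses are, up to natural isomorphism, induced by $R\otimes_R-$ and by $\operatorname{Hom}_R(R,-)$, respectively. In particular, these functors restrict to mutually inverse additive equivalences $$\operatorname{Hom}_R(R,-)\colon R\text{-}{}^t\mathrm{Mod}\;\rightleftarrows\;R\text{-}{}^c\mathrm{Mod}\;\colon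 R\otimes_R-,$$ the first of which is naturally isomorphic to the composition of the two equivalences above. Moreover, the two restricted functors form an ambidextrous adjunction: $R\otimes_R-$ is left adjoint to $\operatorname{Hom}_R(R,-)$, with counit $R\otimes_R\operatorname{Hom}_R(R,M)\to M$, $r\otimes f\mapsto f(r)$; and $R\otimes_R-$ is also right adjoint to $\operatorname{Hom}_R(R,-)$, by an adjunction with unit $\eta$ and counit $\varepsilon$ satisfying $\eta_M\circ\mu_M=R\otimes_R\nu_M$ for t-unital $M$ and $\nu_P\circ\varepsilon_P=\operatorname{Hom}_R(R,\mu_P)$ for c-unital $P$. -/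

import Mathlib

open CategoryTheory
open scoped TensorProduct

universe u

namespace TUnital

/-! ### Nonunital modules

Rings are associative and not necessarily unital (`NonUnitalRing`). -/

/-- A nonunital left module over the nonunital ring `R`: an abelian group with an action of `R`
which is biadditive and associative. -/
class NonunitalModule (R M : Type u) [NonUnitalRing R] [AddCommGroup M] extends SMul R M where
  act_add (r : R) (m n : M) : r • (m + n) = r • m + r • n
  add_act (r s : R) (m : M) : (r + s) • m = r • m + s • m
  mul_act (r s : R) (m : M) : (r * s) • m = r • s • m

/-- The unitalization `ℤ ⊕ R`, in which `R` is a two-sided ideal. -/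
def Unitalization (R : Type u) [NonUnitalRing R] : Type u := Unitization ℤ R

namespace Unitalization

variable {R : Type u} [NonUnitalRing R]

instance : Ring (Unitalization R) := inferInstanceAs (Ring (Unitization ℤ R))

/-- The component in `ℤ`. -/
def fst (a : Unitalization R) : ℤ := (show Unitization ℤ R from a).toProd.1

/-- The component in `R`. -/
def snd (a : Unitalization R) : R := (show Unitization ℤ R from a).toProd.2

/-- The inclusion of the ideal `R`. -/
def incl (r : R) : Unitalization R := Unitization.inr r

@[ext]
theorem ext {a b : Unitalization R} (h₁ : a.fst = b.fst) (h₂ : a.snd = b.snd) : a = b :=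
  Unitization.ext h₁ h₂

@[simp] theorem fst_zero : (0 : Unitalization R).fst = 0 := rfl
@[simp] theorem snd_zero : (0 : Unitalization R).snd = 0 := rfl
@[simp] theorem fst_one : (1 : Unitalization R).fst = 1 := rfl
@[simp] theorem snd_one : (1 : Unitalization R).snd = 0 := rfl
@[simp] theorem fst_add (a b : Unitalization R) : (a + b).fst = a.fst + b.fst := rfl
@[simp] theorem snd_add (a b : Unitalization R) : (a + b).snd = a.snd + b.snd := rfl
@[simp] theorem fst_mul (a b : Unitalization R) : (a * b).fst = a.fst * b.fst := rfl
@[simp] theorem snd_mul (a b : Unitalization R) :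
    (a * b).snd = a.fst • b.snd + b.fst • a.snd + a.snd * b.snd := rfl
@[simp] theorem fst_incl (r : R) : (incl r).fst = 0 := rfl
@[simp] theorem snd_incl (r : R) : (incl r).snd = r := rfl

theorem incl_add (r s : R) : incl (r + s) = incl r + incl s := by ext <;> simp

theorem incl_mul (r s : R) : incl (r * s) = incl r * incl s := by ext <;> simp

theorem eq_intCast_add_incl (a : Unitalization R) : a = (a.fst : Unitalization R) + incl a.snd := by
  let f : Unitalization R →+ ℤ := ⟨⟨fst, rfl⟩, fst_add⟩
  let g : Unitalization R →+ R := ⟨⟨snd, rfl⟩, snd_add⟩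
  have hf (n : ℤ) : (n : Unitalization R).fst = n := by
    rw [← zsmul_one]
    exact (map_zsmul f n 1).trans (by change n • (1 : ℤ) = n; simp)
  have hg (n : ℤ) : (n : Unitalization R).snd = 0 := by
    rw [← zsmul_one]
    exact (map_zsmul g n 1).trans (by change n • (0 : R) = 0; simp)
  ext <;> simp [hf, hg]

end Unitalization

open Unitalization (incl)

section Nonunital

variable (R M : Type u) [NonUnitalRing R] [AddCommGroup M]

/-- A nonunital `R`-module is a unital module over `ℤ ⊕ R`, with `(n + r) m = n m + r m`. -/
abbrev NonunitalModule.toUnital [NonunitalModule R M] : Module (Unitalization R) M :=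
  let f : R →+ M →+ M := AddMonoidHom.mk' (fun r => AddMonoidHom.mk' (fun m => r • m)
    (NonunitalModule.act_add r)) (fun r s => by ext m; exact NonunitalModule.add_act r s m)
  { smul := fun a m => a.fst • m + a.snd • m
    one_smul := fun m => by
      change (1 : ℤ) • m + f 0 m = m
      simp
    mul_smul := fun a b m => by
      have hf (r s : R) : f (r * s) m = f r (f s m) := NonunitalModule.mul_act r s m
      change (a.fst * b.fst) • m + f (a.fst • b.snd + b.fst • a.snd + a.snd * b.snd) m
        = a.fst • (b.fst • m + f b.snd m) + f a.snd (b.fst • m + f b.snd m)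
      simp only [map_add, map_zsmul, AddMonoidHom.add_apply, hf, smul_add, mul_smul,
        AddMonoidHom.smul_apply]
      abel
    smul_zero := fun a => by
      change a.fst • (0 : M) + f a.snd 0 = 0
      simp
    smul_add := fun a m n => by
      change a.fst • (m + n) + f a.snd (m + n) = (a.fst • m + f a.snd m) + (a.fst • n + f a.snd n)
      rw [smul_add, map_add]
      abel
    add_smul := fun a b m => by
      change (a.fst + b.fst) • m + f (a.snd + b.snd) m
        = (a.fst • m + f a.snd m) + (b.fst • m + f b.snd m)
      rw [add_smul, map_add, AddMonoidHom.add_apply]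
      abel
    zero_smul := fun m => by
      change (0 : ℤ) • m + f 0 m = 0
      simp }

/-- Conversely, a unital module over `ℤ ⊕ R` is a nonunital `R`-module by restriction. -/
abbrev NonunitalModule.ofUnital [Module (Unitalization R) M] : NonunitalModule R M where
  smul r m := incl r • m
  act_add r m n := smul_add (incl r) m n
  add_act r s m := by
    change incl (r + s) • m = incl r • m + incl s • m
    rw [Unitalization.incl_add, add_smul]
  mul_act r s m := by
    change incl (r * s) • m = incl r • incl s • m
    rw [Unitalization.incl_mul, mul_smul]

variable {R M}

/-- In a unital `ℤ ⊕ R`-module, the scalar `n + r` acts by `m ↦ n m + r m`. So the two passages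
between nonunital `R`-modules and unital `ℤ ⊕ R`-modules are mutually inverse. -/
theorem smul_eq [Module (Unitalization R) M] (a : Unitalization R) (m : M) :
    a • m = a.fst • m + incl a.snd • m := by
  conv_lhs => rw [Unitalization.eq_intCast_add_incl a, add_smul, Int.cast_smul_eq_zsmul]

/-- An additive map between `ℤ ⊕ R`-modules that commutes with the action of `R` is
`ℤ ⊕ R`-linear, so the `ℤ ⊕ R`-linear maps are exactly the maps of nonunital `R`-modules. -/
def linearOfCommutes {M N : Type u} [AddCommGroup M] [AddCommGroup N]
    [Module (Unitalization R) M] [Module (Unitalization R) N] (f : M →+ N)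
    (hf : ∀ (r : R) (m : M), f (incl r • m) = incl r • f m) :
    M →ₗ[Unitalization R] N where
  toFun := f
  map_add' := f.map_add
  map_smul' a m := by
    rw [smul_eq a m, map_add, map_zsmul, hf, RingHom.id_apply, smul_eq a (f m)]

end Nonunital

variable (R : Type u) [NonUnitalRing R]

/-- `R` as a nonunital left module over itself, by left multiplication. -/
instance : NonunitalModule R R where
  smul r s := r * s
  act_add r s t := mul_add r s t
  add_act r s t := add_mul r s t
  mul_act r s t := mul_assoc r s t

instance instModuleSelf : Module (Unitalization R) R := NonunitalModule.toUnital R R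

/-- The abelian category of nonunital left `R`-modules, realized as unital left modules over
`ℤ ⊕ R`: objects and morphisms are the same by the preceding facts. -/
abbrev NMod := ModuleCat.{u} (Unitalization R)

/-! ### The tensor product `R ⊗_R M` -/

section Tensor

variable (M : Type u) [AddCommGroup M] [Module (Unitalization R) M]

/-- The additive subgroup of `R ⊗_ℤ M` generated by the elements `r s ⊗ m - r ⊗ s m`; it is
stable under the left action of `R`. -/
def tensorRel : Submodule (Unitalization R) (R ⊗[ℤ] M) where
  __ := AddSubgroup.closure {x : R ⊗[ℤ] M | ∃ (r s : R) (m : M),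
    x = (r * s) ⊗ₜ[ℤ] m - r ⊗ₜ[ℤ] (incl s • m)}
  smul_mem' a x hx := by
    change x ∈ AddSubgroup.closure _ at hx
    change a • x ∈ AddSubgroup.closure _
    induction hx using AddSubgroup.closure_induction with
    | mem x hx =>
      obtain ⟨r, s, m, rfl⟩ := hx
      apply AddSubgroup.subset_closure
      refine ⟨a • r, s, m, ?_⟩
      rw [smul_sub, TensorProduct.smul_tmul', TensorProduct.smul_tmul']
      congr 2
      change a.fst • (r * s) + a.snd * (r * s) = (a.fst • r + a.snd * r) * s
      rw [add_mul, smul_mul_assoc, mul_assoc]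
    | zero => rw [smul_zero]; exact AddSubgroup.zero_mem _
    | add x y _ _ hx hy => rw [smul_add]; exact AddSubgroup.add_mem _ hx hy
    | neg x _ hx => rw [smul_neg]; exact AddSubgroup.neg_mem _ hx

/-- The tensor product `R ⊗_R M` over the nonunital ring `R`, with the left action of `R`
through the left factor. -/
abbrev TensorR : Type u := (R ⊗[ℤ] M) ⧸ tensorRel R M

variable {M}

/-- The element `r ⊗ m` of `R ⊗_R M`. -/
def tmulR (r : R) (m : M) : TensorR R M := Submodule.Quotient.mk (r ⊗ₜ[ℤ] m)

/-- The map `R ⊗_R f : R ⊗_R M → R ⊗_R N`, `r ⊗ m ↦ r ⊗ f m`. -/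
def tensorMap {N : Type u} [AddCommGroup N] [Module (Unitalization R) N]
    (f : M →ₗ[Unitalization R] N) : TensorR R M →ₗ[Unitalization R] TensorR R N :=
  (tensorRel R M).mapQ (tensorRel R N)
    (TensorProduct.AlgebraTensorModule.lTensor (Unitalization R) R (f.restrictScalars ℤ)) (by
      change AddSubgroup.closure _ ≤ ((tensorRel R N).comap
        (TensorProduct.AlgebraTensorModule.lTensor (Unitalization R) R
          (f.restrictScalars ℤ))).toAddSubgroup
      rw [AddSubgroup.closure_le]
      rintro _ ⟨r, s, m, rfl⟩
      refine AddSubgroup.subset_closure ⟨r, s, f m, ?_⟩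
      simp)

variable (M)

/-- The natural map `R ⊗_R M → M`, `r ⊗ m ↦ r m`. -/
def mulMap : TensorR R M →ₗ[Unitalization R] M :=
  (tensorRel R M).liftQ
    (TensorProduct.AlgebraTensorModule.lift
      { toFun := fun r =>
          { toFun := fun m => incl r • m
            map_add' := fun m n => smul_add _ m n
            map_smul' := fun c m => smul_comm _ c m }
        map_add' := fun r s => by
          ext m
          change incl (r + s) • m = _
          rw [Unitalization.incl_add, add_smul]
          rfl
        map_smul' := fun a r => by
          ext m
          change incl (a • r) • m = a • incl r • m
          rw [← mul_smul]
          congr 1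
          ext
          · simp
          · change a.fst • r + a.snd * r = _
            simp })
    (by
      change AddSubgroup.closure _ ≤ (LinearMap.ker _).toAddSubgroup
      rw [AddSubgroup.closure_le]
      rintro _ ⟨r, s, m, rfl⟩
      change _ = _
      rw [map_sub, sub_eq_zero]
      change incl (r * s) • m = incl r • incl s • m
      rw [Unitalization.incl_mul, mul_smul])

variable {M}

@[simp]
theorem tensorMap_tmulR {N : Type u} [AddCommGroup N] [Module (Unitalization R) N]
    (f : M →ₗ[Unitalization R] N) (r : R) (m : M) :
    tensorMap R f (tmulR R r m) = tmulR R r (f m) := rfl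

@[simp]
theorem mulMap_tmulR (r : R) (m : M) :
    mulMap R M (tmulR R r m) = incl r • m := rfl

/-- Linear maps out of `R ⊗_R M` are determined by their values on the elements `r ⊗ m`. -/
theorem tensorR_ext {N : Type u} [AddCommGroup N] [Module (Unitalization R) N]
    {f g : TensorR R M →ₗ[Unitalization R] N}
    (h : ∀ r m, f (tmulR R r m) = g (tmulR R r m)) : f = g := by
  refine Submodule.linearMap_qext _ (LinearMap.ext fun x => ?_)
  induction x using TensorProduct.induction_on with
  | zero => simp
  | tmul r m => exact h r m
  | add x y hx hy => rw [map_add, map_add, hx, hy]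

end Tensor

/-! ### The module `Hom_R(R, P)` -/

section Hom

/-- Right multiplication by an element of `ℤ ⊕ R`, a map of left `R`-modules `R → R`. -/
def rightMul (a : Unitalization R) : R →ₗ[Unitalization R] R where
  toFun r := a.fst • r + r * a.snd
  map_add' r s := by rw [smul_add, add_mul]; abel
  map_smul' b r := by
    change a.fst • (b.fst • r + b.snd * r) + (b.fst • r + b.snd * r) * a.snd
      = b.fst • (a.fst • r + r * a.snd) + b.snd * (a.fst • r + r * a.snd)
    simp only [smul_add, add_mul, mul_add, smul_mul_assoc, mul_smul_comm, mul_assoc,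
      smul_comm a.fst b.fst r]
    abel

variable (P : Type u) [AddCommGroup P] [Module (Unitalization R) P]

/-- The abelian group `Hom_R(R, P)` of maps of left `R`-modules `R → P`. -/
def HomR : Type u := R →ₗ[Unitalization R] P

instance : AddCommGroup (HomR R P) :=
  inferInstanceAs (AddCommGroup (R →ₗ[Unitalization R] P))

instance : FunLike (HomR R P) R P :=
  inferInstanceAs (FunLike (R →ₗ[Unitalization R] P) R P)

/-- The left `R`-module structure of `Hom_R(R, P)`, given by `(r f)(s) = f (s r)`. -/
instance : Module (Unitalization R) (HomR R P) where
  smul a f := LinearMap.comp (M₂ := R) f (rightMul R a)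
  one_smul f := by
    refine LinearMap.ext fun r => ?_
    change f ((1 : ℤ) • r + r * 0) = f r
    simp
  mul_smul a b f := by
    refine LinearMap.ext fun r => ?_
    change f ((a.fst * b.fst) • r + r * (a.fst • b.snd + b.fst • a.snd + a.snd * b.snd))
      = f (b.fst • (a.fst • r + r * a.snd) + (a.fst • r + r * a.snd) * b.snd)
    congr 1
    simp only [smul_add, add_mul, mul_add, smul_mul_assoc, mul_smul_comm, mul_assoc, mul_smul,
      smul_comm a.fst b.fst r]
    abel
  smul_zero a := LinearMap.zero_comp _
  smul_add a f g := LinearMap.add_comp _ _ _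
  add_smul a b f := by
    refine LinearMap.ext fun r => ?_
    change f ((a.fst + b.fst) • r + r * (a.snd + b.snd))
      = LinearMap.toAddMonoidHom (R := Unitalization R) f (a.fst • r + r * a.snd)
        + LinearMap.toAddMonoidHom (R := Unitalization R) f (b.fst • r + r * b.snd)
    rw [← map_add]
    change f _ = f _
    congr 1
    rw [add_smul, mul_add]
    abel
  zero_smul f := by
    refine LinearMap.ext fun r => ?_
    change LinearMap.toAddMonoidHom (R := Unitalization R) f ((0 : ℤ) • r + r * 0) = 0
    simp

variable {P}

/-- The map `Hom_R(R, f) : Hom_R(R, P) → Hom_R(R, Q)`, `g ↦ f ∘ g`. -/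
def homMap {Q : Type u} [AddCommGroup Q] [Module (Unitalization R) Q]
    (f : P →ₗ[Unitalization R] Q) : HomR R P →ₗ[Unitalization R] HomR R Q where
  toFun g := LinearMap.comp (M₂ := P) f g
  map_add' _ _ := LinearMap.comp_add _ _ _
  map_smul' _ _ := rfl

variable (P)

/-- The natural map `P → Hom_R(R, P)`, `p ↦ (r ↦ r p)`. -/
def actMap : P →ₗ[Unitalization R] HomR R P where
  toFun p :=
    { toFun := fun r => incl r • p
      map_add' := fun r s => by rw [Unitalization.incl_add, add_smul]
      map_smul' := fun a r => by
        rw [RingHom.id_apply, ← mul_smul]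
        congr 1
        ext
        · simp
        · change a.fst • r + a.snd * r = _
          simp }
  map_add' p q := by
    refine LinearMap.ext fun r => ?_
    exact smul_add (incl r) p q
  map_smul' a p := by
    refine LinearMap.ext fun r => ?_
    change incl r • a • p = incl (a.fst • r + r * a.snd) • p
    rw [← mul_smul]
    congr 1
    ext
    · simp
    · simp

end Hom

/-! ### The functors `R ⊗_R -` and `Hom_R(R, -)` -/

/-- The functor `R ⊗_R -` on nonunital left `R`-modules. -/
def tensorFunctor : NMod R ⥤ NMod R where
  obj M := ModuleCat.of _ (TensorR R M)
  map f := ModuleCat.ofHom (tensorMap R f.hom)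
  map_id M := by
    ext : 1
    exact tensorR_ext R fun _ _ => rfl
  map_comp f g := by
    ext : 1
    exact tensorR_ext R fun _ _ => rfl

/-- The natural transformation `R ⊗_R M → M`, `r ⊗ m ↦ r m`. -/
def tensorUnitality : tensorFunctor R ⟶ 𝟭 (NMod R) where
  app M := ModuleCat.ofHom (mulMap R M)
  naturality M N f := by
    ext : 1
    exact tensorR_ext R fun r m => (f.hom.map_smul (incl r) m).symm

/-- The functor `Hom_R(R, -)` on nonunital left `R`-modules. -/
def homFunctor : NMod R ⥤ NMod R where
  obj P := ModuleCat.of _ (HomR R P)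
  map f := ModuleCat.ofHom (homMap R f.hom)

/-- The natural transformation `P → Hom_R(R, P)`, `p ↦ (r ↦ r p)`. -/
def homUnitality : 𝟭 (NMod R) ⟶ homFunctor R where
  app P := ModuleCat.ofHom (actMap R P)
  naturality P Q f := by
    ext p
    refine LinearMap.ext fun r => ?_
    exact (f.hom.map_smul (incl r) p).symm

/-! ### t-unital, c-unital and null modules -/

/-- `M` is t-unital if the natural map `R ⊗_R M → M` is an isomorphism. -/
def isTUnital : ObjectProperty (NMod R) := fun M => IsIso ((tensorUnitality R).app M)

/-- `P` is c-unital if the natural map `P → Hom_R(R, P)` is an isomorphism. -/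
def isCUnital : ObjectProperty (NMod R) := fun P => IsIso ((homUnitality R).app P)

/-- `M` is a null-module if `r m = 0` for all `r ∈ R` and `m ∈ M`. -/
def isNull : ObjectProperty (NMod R) := fun M => ∀ (r : R) (m : M), incl r • m = 0

/-- The ring `R` is t-unital if the multiplication map `R ⊗_R R → R` is an isomorphism. -/
def IsTUnitalRing : Prop := isTUnital R (ModuleCat.of _ R)

/-- The full subcategory of t-unital left `R`-modules. -/
abbrev TMod := (isTUnital R).FullSubcategory

/-- The full subcategory of c-unital left `R`-modules. -/
abbrev CMod := (isCUnital R).FullSubcategory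

/-- The Serre quotient of the category of nonunital left `R`-modules by the null-modules, i.e. the
localization inverting the morphisms whose kernel and cokernel are null-modules. -/
abbrev SerreQuotient [(isNull R).IsSerreClass] := (isNull R).isoModSerre.Localization

/-- The localization functor to the Serre quotient. -/
noncomputable abbrev quotientFunctor [(isNull R).IsSerreClass] : NMod R ⥤ SerreQuotient R :=
  (isNull R).isoModSerre.Q

/-- A preadditive category is abelian (with its given addition of morphisms). -/
def IsAbelianCategory (C : Type*) [Category C] [h : Preadditive C] : Prop :=
  ∃ A : Abelian C, A.toPreadditive = h

/-- The functor `R ⊗_R -` with values in t-unital modules, provided that all the modules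
`R ⊗_R M` are t-unital. -/
abbrev tensorToT (hT : ∀ M, isTUnital R ((tensorFunctor R).obj M)) : NMod R ⥤ TMod R :=
  (isTUnital R).lift (tensorFunctor R) hT

/-- The functor `Hom_R(R, -)` with values in c-unital modules, provided that all the modules
`Hom_R(R, P)` are c-unital. -/
abbrev homToC (hC : ∀ P, isCUnital R ((homFunctor R).obj P)) : NMod R ⥤ CMod R :=
  (isCUnital R).lift (homFunctor R) hC

end TUnital

open TUnital

/-! Write T = R ⊗_R - and H = Hom_R(R, -), so that T ⊣ H. Over any R, the maps μ and ν correspond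
under this adjunction (`homEquiv_unitality`), and they have null kernels and cokernels because s·x =
s ⊗ μ(x) and s·f = ν(f s). If R is t-unital, then R = R², so null-modules are closed under
extensions; uncurrying maps R → H P along R ⊗_R R ≅ R shows that H P is c-unital, and T M is
t-unital by adjunction.

The key point is `isCUnital.bijective_comp`: c-unital modules are local for the maps with null
kernel and cokernel. It follows that both T and H invert these maps, hence factor through the Serre
quotient, where μ and ν become invertible. This gives the two equivalences. As T ν and H μ are
invertible too, the unit μ⁻¹ ≫ T ν and counit H μ ≫ ν⁻¹ make H ⊣ T an adjoint equivalence between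
t-unital and c-unital modules. -/

namespace TUnital

/-! ### Localizations, abelian categories and adjunctions on full subcategories -/

section Categories

universe v₁ v₂ u₁ u₂

/-- A full subcategory is equivalent to a localization if a functor to it, which inverts the given
morphisms, is isomorphic to the identity both on the subcategory and after
localization. -/
noncomputable def localizationEquivalence {C : Type u₁} [Category.{v₁} C]
    {W : MorphismProperty C} {P : ObjectProperty C} (F : C ⥤ P.FullSubcategory)
    (hF : W.IsInvertedBy F) (α : P.ι ⋙ F ≅ 𝟭 _) (β : (F ⋙ P.ι) ⋙ W.Q ≅ W.Q) :
    P.FullSubcategory ≌ W.Localization :=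
  -- Both functors are kept on the nose, so later identifications of them hold by `rfl`. The second
  -- isomorphism need only be given after precomposition with `W.Q`.
  CategoryTheory.Equivalence.mk (P.ι ⋙ W.Q) (Localization.lift F hF W.Q)
    (α.symm ≪≫ Functor.isoWhiskerLeft P.ι (Localization.fac F hF W.Q).symm)
    (letI : Localization.Lifting W.Q W ((F ⋙ P.ι) ⋙ W.Q)
        (Localization.lift F hF W.Q ⋙ P.ι ⋙ W.Q) :=
      ⟨Functor.isoWhiskerRight (Localization.fac F hF W.Q) (P.ι ⋙ W.Q)⟩
    letI : Localization.Lifting W.Q W W.Q (𝟭 W.Localization) := ⟨W.Q.rightUnitor⟩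
    Localization.liftNatIso W.Q W ((F ⋙ P.ι) ⋙ W.Q) W.Q _ _ β)

/-- Kernels, cokernels and normality transfer along any equivalence, since it preserves zero
morphisms; `C` keeps its own addition. -/
theorem IsAbelianCategory.of_equivalence {C : Type u₁} [Category.{v₁} C] [Preadditive C]
    {D : Type u₂} [Category.{v₂} D] [hD : Preadditive D] (e : C ≌ D)
    (h : IsAbelianCategory D) : IsAbelianCategory C := by
  obtain ⟨A, rfl⟩ := h
  have : Limits.HasFiniteProducts C :=
    ⟨fun n => Adjunction.hasLimitsOfShape_of_equivalence e.functor⟩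
  exact ⟨abelianOfEquivalence e.functor, rfl⟩

section Adjunctions

variable {C : Type u₁} [Category.{v₁} C] {P Q : ObjectProperty C} {T H : C ⥤ C}

/-- The restriction of an adjunction between endofunctors to full subcategories. -/
noncomputable def fullSubcategoryAdjunction (adj : T ⊣ H) (hT : ∀ X, P (T.obj X))
    (hH : ∀ X, Q (H.obj X)) : Q.ι ⋙ P.lift T hT ⊣ P.ι ⋙ Q.lift H hH :=
  Adjunction.mkOfUnitCounit
    { unit :=
        { app := fun X => ObjectProperty.homMk (adj.unit.app X.obj)
          naturality := fun _ _ f => ObjectProperty.hom_ext _ (adj.unit.naturality f.hom) }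
      counit :=
        { app := fun X => ObjectProperty.homMk (adj.counit.app X.obj)
          naturality := fun _ _ f => ObjectProperty.hom_ext _ (adj.counit.naturality f.hom) }
      left_triangle := by
        ext X
        simp
      right_triangle := by
        ext X
        simp }

/-- An idempotent copointed endofunctor `T` and an idempotent pointed endofunctor `H` define an
adjunction `H ⊣ T` between their full subcategories of fixed objects. -/
noncomputable def fixedObjectsAdjunction (μ : T ⟶ 𝟭 C) (ν : 𝟭 C ⟶ H)
    (hP : ∀ X : P.FullSubcategory, IsIso (μ.app X.obj))
    (hQ : ∀ X : Q.FullSubcategory, IsIso (ν.app X.obj))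
    (hT : ∀ X, P (T.obj X)) (hH : ∀ X, Q (H.obj X))
    (hμ : ∀ X, T.map (μ.app X) = μ.app (T.obj X))
    (hν : ∀ X, H.map (ν.app X) = ν.app (H.obj X)) :
    P.ι ⋙ Q.lift H hH ⊣ Q.ι ⋙ P.lift T hT :=
  Adjunction.mkOfUnitCounit
    { unit :=
        { app := fun X => ObjectProperty.homMk (inv (μ.app X.obj) ≫ T.map (ν.app X.obj))
          naturality := fun X Y f => by
            ext
            have h₁ := μ.naturality f.hom
            have h₂ := ν.naturality f.hom
            dsimp at h₁ h₂ ⊢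
            rw [← cancel_epi (μ.app X.obj)]
            simp only [Category.assoc, IsIso.hom_inv_id_assoc, ← Functor.map_comp]
            rw [← h₂, Functor.map_comp, ← reassoc_of% h₁, IsIso.hom_inv_id_assoc] }
      counit :=
        { app := fun X => ObjectProperty.homMk (H.map (μ.app X.obj) ≫ inv (ν.app X.obj))
          naturality := fun X Y f => by
            ext
            have h₁ := μ.naturality f.hom
            have h₂ := ν.naturality f.hom
            dsimp at h₁ h₂ ⊢
            rw [← cancel_mono (ν.app Y.obj)]
            simp only [Category.assoc, IsIso.inv_hom_id, Category.comp_id]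
            rw [h₂, IsIso.inv_hom_id_assoc, ← Functor.map_comp, ← Functor.map_comp, h₁] }
      left_triangle := by
        ext X
        -- T ν ≫ μ = μ ≫ ν reduces the composite to H ν_X followed by ν_{HX}⁻¹, which is the
        -- identity by `hν`.
        have h := μ.naturality (ν.app X.obj)
        have := hQ ⟨_, hH X.obj⟩
        dsimp at h this ⊢
        simp only [Category.id_comp]
        rw [← Functor.map_comp_assoc, Category.assoc, h, IsIso.inv_hom_id_assoc, hν,
          IsIso.hom_inv_id]
      right_triangle := by
        ext X
        -- Dually, the composite reduces to μ_{TX}⁻¹ followed by T μ_X.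
        have h := ν.naturality (μ.app X.obj)
        have := hP ⟨_, hT X.obj⟩
        dsimp at h this ⊢
        simp only [Category.id_comp, Category.assoc]
        rw [← Functor.map_comp, ← reassoc_of% h, IsIso.hom_inv_id, Category.comp_id, hμ,
          IsIso.inv_hom_id] }

end Adjunctions

end Categories

open _root_.TUnital.Unitalization (incl)

variable {R : Type u} [NonUnitalRing R]

/-! ### Calculus of elements in R ⊗_R M and Hom_R(R, P) -/

section Elements

variable {M N P : Type u} [AddCommGroup M] [Module (Unitalization R) M]
  [AddCommGroup N] [Module (Unitalization R) N] [AddCommGroup P] [Module (Unitalization R) P]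

theorem incl_smul_self (r s : R) : incl r • s = r * s := by
  change (0 : ℤ) • s + r * s = r * s
  simp

theorem homR_ext {f g : HomR R P} (h : ∀ r, f r = g r) : f = g :=
  DFunLike.ext f g h

theorem homR_add_apply (f g : HomR R P) (r : R) : (f + g) r = f r + g r := rfl

theorem homR_zero_apply (r : R) : (0 : HomR R P) r = 0 := rfl

theorem homR_smul_apply (a : Unitalization R) (f : HomR R P) (r : R) :
    (a • f) r = f (rightMul R a r) := rfl

theorem homR_map_smul (f : HomR R P) (a : Unitalization R) (r : R) : f (a • r) = a • f r :=
  LinearMap.map_smul (R := Unitalization R) (M := R) (M₂ := P) f a r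

theorem homR_map_add (f : HomR R P) (r s : R) : f (r + s) = f r + f s :=
  map_add (show R →ₗ[Unitalization R] P from f) r s

theorem rightMul_incl (r s : R) : rightMul R (incl s) r = r * s := by
  change (0 : ℤ) • r + r * s = r * s
  simp

theorem homR_incl_smul_apply (f : HomR R P) (r s : R) : (incl s • f) r = f (r * s) := by
  rw [homR_smul_apply, rightMul_incl]

theorem homR_map_mul (f : HomR R P) (r s : R) : f (r * s) = incl r • f s := by
  rw [← homR_map_smul, incl_smul_self]

@[simp]
theorem actMap_apply (p : P) (r : R) : actMap R P p r = incl r • p := rfl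

theorem tmulR_add (r : R) (m n : M) : tmulR R r (m + n) = tmulR R r m + tmulR R r n := by
  simp only [tmulR, TensorProduct.tmul_add]
  rfl

theorem add_tmulR (r s : R) (m : M) : tmulR R (r + s) m = tmulR R r m + tmulR R s m := by
  simp only [tmulR, TensorProduct.add_tmul]
  rfl

theorem smul_tmulR (a : Unitalization R) (r : R) (m : M) :
    a • tmulR R r m = tmulR R (a • r) m := rfl

theorem mul_tmulR (r s : R) (m : M) : tmulR R (r * s) m = tmulR R r (incl s • m) := by
  rw [tmulR, tmulR, Submodule.Quotient.eq]
  exact AddSubgroup.subset_closure ⟨r, s, m, rfl⟩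

theorem incl_smul_tmulR (r s : R) (m : M) :
    incl s • tmulR R r m = tmulR R s (incl r • m) := by
  rw [smul_tmulR, incl_smul_self, mul_tmulR]

@[elab_as_elim]
theorem tensorR_induction {p : TensorR R M → Prop} (x : TensorR R M)
    (tmul : ∀ r m, p (tmulR R r m)) (zero : p 0) (add : ∀ x y, p x → p y → p (x + y)) : p x := by
  obtain ⟨x, rfl⟩ := Submodule.Quotient.mk_surjective _ x
  induction x using TensorProduct.induction_on with
  | zero => exact zero
  | tmul r m => exact tmul r m
  | add x y hx hy => exact add _ _ hx hy

/-- `R` annihilates the kernel of the multiplication map `R ⊗_R M → M`. -/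
theorem incl_smul_eq_tmulR_mulMap (s : R) (x : TensorR R M) :
    incl s • x = tmulR R s (mulMap R M x) := by
  induction x using tensorR_induction with
  | tmul r m => rw [incl_smul_tmulR, mulMap_tmulR]
  | zero =>
    rw [smul_zero, map_zero]
    exact (map_zero (AddMonoidHom.mk' (fun m : M => tmulR R s m) (tmulR_add s))).symm
  | add x y hx hy => rw [smul_add, hx, hy, map_add, tmulR_add]

/-- `R` maps `Hom_R(R, P)` to the image of `P`. -/
theorem incl_smul_eq_actMap (s : R) (f : HomR R P) : incl s • f = actMap R P (f s) :=
  homR_ext fun r => by rw [homR_incl_smul_apply, actMap_apply, homR_map_mul]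

/-- The map `R ⊗_R M → P`, `r ⊗ m ↦ g m r`, associated with a map `g : M → Hom_R(R, P)`. -/
def homUncurry (g : M →ₗ[Unitalization R] HomR R P) : TensorR R M →ₗ[Unitalization R] P :=
  (tensorRel R M).liftQ
    (TensorProduct.AlgebraTensorModule.lift
      { toFun := fun r =>
          { toFun := fun m => g m r
            map_add' := fun m n => by rw [map_add, homR_add_apply]
            map_smul' := fun c m => by
              rw [map_zsmul]
              exact map_zsmul (AddMonoidHom.mk' (fun f : HomR R P => f r) fun _ _ => rfl) c (g m) }
        map_add' := fun r s => LinearMap.ext fun m => homR_map_add (g m) r s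
        map_smul' := fun a r => LinearMap.ext fun m => homR_map_smul (g m) a r })
    (by
      change AddSubgroup.closure _ ≤ (LinearMap.ker _).toAddSubgroup
      rw [AddSubgroup.closure_le]
      rintro _ ⟨r, s, m, rfl⟩
      change _ = _
      rw [map_sub, sub_eq_zero]
      change g m (r * s) = g (incl s • m) r
      rw [map_smul, homR_incl_smul_apply])

/-- The map `M → Hom_R(R, P)`, `m ↦ (r ↦ f (r ⊗ m))`, associated with a map
`f : R ⊗_R M → P`. -/
def homCurry (f : TensorR R M →ₗ[Unitalization R] P) : M →ₗ[Unitalization R] HomR R P :=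
  linearOfCommutes
    (AddMonoidHom.mk' (fun m : M => show HomR R P from
      ({ toFun := fun r => f (tmulR R r m)
         map_add' := fun r s => by rw [add_tmulR, map_add]
         map_smul' := fun a r => by rw [← smul_tmulR, map_smul, RingHom.id_apply] } :
        R →ₗ[Unitalization R] P))
      fun m n => homR_ext fun r => (congrArg f (tmulR_add r m n)).trans (map_add f _ _))
    fun s m => homR_ext fun r => by
      rw [homR_incl_smul_apply]
      exact (congrArg f (mul_tmulR r s m)).symm

end Elements

/-! ### The tensor-Hom adjunction and its compatibility with μ and ν -/

variable (R) in
/-- The functor `R ⊗_R -` is left adjoint to `Hom_R(R, -)`. -/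
def tensorHomAdjunction : tensorFunctor R ⊣ homFunctor R :=
  Adjunction.mkOfHomEquiv
    { homEquiv := fun M P =>
        { toFun := fun f => ModuleCat.ofHom (homCurry f.hom)
          invFun := fun g => ModuleCat.ofHom (homUncurry (P := P) g.hom)
          left_inv := fun f => by
            ext : 1
            exact tensorR_ext R fun r m => rfl
          right_inv := fun g => by
            ext m
            exact homR_ext fun r => rfl }
      homEquiv_naturality_left_symm := fun f g => by
        ext : 1
        exact tensorR_ext R fun r m => rfl
      homEquiv_naturality_right := fun f g => by
        ext m
        exact homR_ext fun r => rfl }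

/-- The maps `R ⊗_R M → M` and `P → Hom_R(R, P)` are conjugate. -/
theorem homEquiv_unitality {M P : NMod R} (g : M ⟶ P) :
    (tensorHomAdjunction R).homEquiv M P ((tensorUnitality R).app M ≫ g) =
      g ≫ (homUnitality R).app P := by
  ext m
  exact homR_ext fun r => g.hom.map_smul (incl r) m

/-- On r ⊗ x this is the identity r ⊗ μ(x) = r·x. -/
theorem tensorFunctor_map_tensorUnitality (M : NMod R) :
    (tensorFunctor R).map ((tensorUnitality R).app M) =
      (tensorUnitality R).app ((tensorFunctor R).obj M) := by
  ext : 1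
  refine tensorR_ext R fun r x => ?_
  exact (incl_smul_eq_tmulR_mulMap r x).symm

theorem homFunctor_map_homUnitality (P : NMod R) :
    (homFunctor R).map ((homUnitality R).app P) =
      (homUnitality R).app ((homFunctor R).obj P) := by
  ext f
  exact homR_ext fun r => (incl_smul_eq_actMap r f).symm

/-! ### t-unital rings: H P is c-unital and T M is t-unital -/

section TUnitalRing

theorem IsTUnitalRing.mulMap_bijective (hR : IsTUnitalRing R) :
    Function.Bijective (mulMap R R) :=
  (ConcreteCategory.isIso_iff_bijective _).1 (show IsIso ((tensorUnitality R).app _) from hR)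

/-- Over a t-unital ring, every element is a sum of products. -/
theorem IsTUnitalRing.induction_mul (hR : IsTUnitalRing R) {p : R → Prop} (r : R)
    (mul : ∀ s t, p (s * t)) (zero : p 0) (add : ∀ s t, p s → p t → p (s + t)) : p r := by
  obtain ⟨x, rfl⟩ := hR.mulMap_bijective.2 r
  induction x using tensorR_induction with
  | tmul r s => rw [mulMap_tmulR, incl_smul_self]; exact mul r s
  | zero => rw [map_zero]; exact zero
  | add x y hx hy => rw [map_add]; exact add _ _ hx hy

/-- Injectivity uses only R = R²: if R f = 0, then f vanishes on products. Surjectivity uses that R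
⊗_R R → R is invertible. -/
theorem IsTUnitalRing.actMap_homR_bijective (hR : IsTUnitalRing R) (P : Type u) [AddCommGroup P]
    [Module (Unitalization R) P] : Function.Bijective (actMap R (HomR R P)) := by
  constructor
  · rw [← LinearMap.ker_eq_bot, LinearMap.ker_eq_bot']
    intro f hf
    refine homR_ext fun r => ?_
    rw [homR_zero_apply]
    induction r using hR.induction_mul with
    | mul r s =>
      rw [← homR_incl_smul_apply, ← actMap_apply, hf]
      rfl
    | zero => exact map_zero (show R →ₗ[Unitalization R] P from f)
    | add x y hx hy => rw [homR_map_add, hx, hy, add_zero]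
  · intro F
    let e := LinearEquiv.ofBijective (mulMap R R) hR.mulMap_bijective
    -- A preimage of F must satisfy f(s r) = (F r)(s), so it is s ⊗ r ↦ (F r)(s) transported along R
    -- ≅ R ⊗_R R.
    let f : HomR R P := LinearMap.comp (M₂ := TensorR R R) (homUncurry F) e.symm.toLinearMap
    refine ⟨f, homR_ext fun r => homR_ext fun s => ?_⟩
    have h : e.symm (s * r) = tmulR R s r := by
      rw [LinearEquiv.symm_apply_eq, LinearEquiv.ofBijective_apply, mulMap_tmulR, incl_smul_self]
    rw [actMap_apply, homR_incl_smul_apply]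
    exact congrArg (homUncurry F) h

theorem IsTUnitalRing.isCUnital_homFunctor_obj (hR : IsTUnitalRing R) (P : NMod R) :
    isCUnital R ((homFunctor R).obj P) :=
  (ConcreteCategory.isIso_iff_bijective _).2 (hR.actMap_homR_bijective P)

/-- By Yoneda it suffices to precompose with T μ_M. Two uses of the adjunction turn this into
postcomposition with ν_{HP} on maps M → H P, and ν_{HP} is invertible. -/
theorem IsTUnitalRing.isTUnital_tensorFunctor_obj (hR : IsTUnitalRing R) (M : NMod R) :
    isTUnital R ((tensorFunctor R).obj M) := by
  rw [isTUnital, ← tensorFunctor_map_tensorUnitality, isIso_iff_coyoneda_map_bijective]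
  intro P
  have : IsIso ((homUnitality R).app ((homFunctor R).obj P)) := hR.isCUnital_homFunctor_obj P
  let adj := tensorHomAdjunction R
  rw [← (adj.homEquiv _ P).comp_bijective, ← (adj.homEquiv M ((homFunctor R).obj P)).comp_bijective]
  have h : (adj.homEquiv M ((homFunctor R).obj P)) ∘ (adj.homEquiv ((tensorFunctor R).obj M) P) ∘
      (fun x => (tensorFunctor R).map ((tensorUnitality R).app M) ≫ x) =
      (fun y => y ≫ (homUnitality R).app ((homFunctor R).obj P)) ∘ adj.homEquiv M P := by
    ext1 x
    exact (congrArg _ (adj.homEquiv_naturality_left _ _)).trans (homEquiv_unitality _)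
  exact h ▸ ((isIso_iff_yoneda_map_bijective _).1 this M).comp (adj.homEquiv M P).bijective

end TUnitalRing

/-! ### Null-modules form a Serre class -/

theorem isNull_of_injective {M N : NMod R} (f : M ⟶ N) (hf : Function.Injective f.hom)
    (hN : isNull R N) : isNull R M := fun r m =>
  hf (by rw [map_smul, hN, map_zero])

theorem isNull_of_surjective {M N : NMod R} (f : M ⟶ N) (hf : Function.Surjective f.hom)
    (hM : isNull R M) : isNull R N := fun r n => by
  obtain ⟨m, rfl⟩ := hf n
  rw [← map_smul, hM, map_zero]

theorem IsTUnitalRing.isSerreClass (hR : IsTUnitalRing R) : (isNull R).IsSerreClass where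
  exists_zero := ⟨ModuleCat.of _ PUnit, ModuleCat.isZero_of_subsingleton _, fun _ _ => rfl⟩
  prop_of_mono f _ hN := isNull_of_injective f ((ModuleCat.mono_iff_injective f).1 ‹_›) hN
  prop_of_epi f _ hM := isNull_of_surjective f ((ModuleCat.epi_iff_surjective f).1 ‹_›) hM
  prop_X₂_of_shortExact {S} hS h₁ h₃ r m := by
    induction r using hR.induction_mul with
    | mul s t =>
      -- The factor t moves m into the null submodule, where s then kills it; hence products
      -- annihilate the extension.
      obtain ⟨k, hk⟩ := (S.moduleCat_exact_iff.1 hS.exact) (incl t • m) (by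
        rw [ConcreteCategory.hom]
        exact (S.g.hom.map_smul _ _).trans (h₃ _ _))
      rw [Unitalization.incl_mul, mul_smul, ← hk]
      exact (S.f.hom.map_smul _ _).symm.trans ((congrArg _ (h₁ s k)).trans (map_zero S.f.hom))
    | zero => exact zero_smul _ m
    | add s t hs ht => rw [Unitalization.incl_add, add_smul, hs, ht, add_zero]

/-! ### Isomorphisms modulo null-modules and their inversion by T and H -/

section Serre

variable [(isNull R).IsSerreClass]

/-- The cokernel of f is null exactly when R N lies in the image of f. -/
theorem isoModSerre_isNull_iff {M N : NMod R} (f : M ⟶ N) :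
    (isNull R).isoModSerre f ↔
      (∀ m, f.hom m = 0 → ∀ r : R, incl r • m = 0) ∧ ∀ n (r : R), ∃ m, f.hom m = incl r • n := by
  rw [ObjectProperty.isoModSerre_iff, ObjectProperty.monoModSerre_iff,
    ObjectProperty.epiModSerre_iff, (isNull R).prop_iff_of_iso (ModuleCat.kernelIsoKer f),
    (isNull R).prop_iff_of_iso (ModuleCat.cokernelIsoRangeQuotient f)]
  refine and_congr ⟨fun h m hm r => congrArg Subtype.val (h r ⟨m, hm⟩),
    fun h r m => Subtype.ext (h m.1 m.2 r)⟩ ⟨fun h n r => ?_, fun h r n => ?_⟩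
  · exact (Submodule.Quotient.mk_eq_zero _).1 (h r (Submodule.Quotient.mk n))
  · obtain ⟨n, rfl⟩ := Submodule.Quotient.mk_surjective _ n
    exact (Submodule.Quotient.mk_eq_zero _).2 (h n r)

theorem isoModSerre_tensorUnitality (M : NMod R) :
    (isNull R).isoModSerre ((tensorUnitality R).app M) := by
  refine (isoModSerre_isNull_iff _).2 ⟨fun x hx r => ?_, fun m r => ⟨tmulR R r m, rfl⟩⟩
  refine (incl_smul_eq_tmulR_mulMap r x).trans ((congrArg (tmulR R r) hx).trans ?_)
  exact map_zero (AddMonoidHom.mk' (fun m : M => tmulR R r m) (tmulR_add r))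

theorem isoModSerre_homUnitality (P : NMod R) :
    (isNull R).isoModSerre ((homUnitality R).app P) :=
  (isoModSerre_isNull_iff _).2 ⟨fun _ hp r => congrArg (fun f : HomR R P => f r) hp,
    fun f r => ⟨(show HomR R P from f) r, (incl_smul_eq_actMap r f).symm⟩⟩

/-- Morphisms whose kernel and cokernel are null-modules are inverted by `Hom(-, P)` for
c-unital `P`. -/
theorem isCUnital.bijective_comp {P : NMod R} (hP : isCUnital R P) {M N : NMod R} {f : M ⟶ N}
    (hf : (isNull R).isoModSerre f) : Function.Bijective fun g : N ⟶ P => f ≫ g := by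
  rw [isoModSerre_isNull_iff] at hf
  obtain ⟨hker, hcoker⟩ := hf
  obtain ⟨hinj, hsurj⟩ : Function.Bijective (actMap R P) :=
    (ConcreteCategory.isIso_iff_bijective _).1 hP
  constructor
  · intro g g' h
    ext n
    -- An element p of P is determined by all r p, and R N lies in the image of f, where the two
    -- maps agree.
    refine hinj (homR_ext fun r => ?_)
    obtain ⟨m, hm⟩ := hcoker n r
    rw [actMap_apply, actMap_apply, ← map_smul, ← map_smul, ← hm]
    exact congrArg (fun k : M ⟶ P => k.hom m) h
  · intro h
    -- R kills ker f, hence also its image under h, and P has no nonzero element killed by R. So h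
    -- descends to h' on the image of f.
    have hle : LinearMap.ker f.hom ≤ LinearMap.ker h.hom := fun m hm => hinj <| homR_ext fun r => by
      rw [actMap_apply, ← map_smul, hker m hm r, map_zero, map_zero]
      rfl
    let h' : LinearMap.range f.hom →ₗ[Unitalization R] P :=
      ((LinearMap.ker f.hom).liftQ h.hom hle).comp f.hom.quotKerEquivRange.symm.toLinearMap
    have hh' (m : M) : h' ⟨f.hom m, m, rfl⟩ = h.hom m := by
      have : f.hom.quotKerEquivRange.symm ⟨f.hom m, m, rfl⟩ = Submodule.Quotient.mk m := by
        rw [LinearEquiv.symm_apply_eq]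
        rfl
      exact (congrArg _ this).trans ((LinearMap.ker f.hom).liftQ_apply (h := hle) h.hom m)
    have hmem (x : TensorR R N) : mulMap R N x ∈ LinearMap.range f.hom := by
      induction x using tensorR_induction with
      | tmul r n => exact hcoker n r
      | zero => rw [map_zero]; exact zero_mem _
      | add x y hx hy => rw [map_add]; exact add_mem hx hy
    let e := LinearEquiv.ofBijective (actMap R P) ⟨hinj, hsurj⟩
    -- The extension sends n to the unique p with r p = h'(r n) for all r.
    refine ⟨ModuleCat.ofHom (e.symm.toLinearMap.comp
      (homCurry (h'.comp ((mulMap R N).codRestrict _ hmem)))), ?_⟩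
    ext m
    change e.symm (homCurry (h'.comp ((mulMap R N).codRestrict _ hmem)) (f.hom m)) = h.hom m
    rw [LinearEquiv.symm_apply_eq]
    refine homR_ext fun r => ?_
    refine Eq.trans ?_ ((hh' (incl r • m)).trans (h.hom.map_smul (incl r) m))
    exact congrArg h' (Subtype.ext (f.hom.map_smul _ _).symm)

/-- Maps T f ≫ - into P correspond to f ≫ - into H P, which is c-unital and so local. -/
theorem IsTUnitalRing.isIso_tensorFunctor_map (hR : IsTUnitalRing R) {M N : NMod R} {f : M ⟶ N}
    (hf : (isNull R).isoModSerre f) : IsIso ((tensorFunctor R).map f) := by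
  rw [isIso_iff_coyoneda_map_bijective]
  intro P
  let adj := tensorHomAdjunction R
  rw [← (adj.homEquiv M P).comp_bijective]
  have h : (adj.homEquiv M P) ∘ (fun x => (tensorFunctor R).map f ≫ x) =
      (fun y => f ≫ y) ∘ adj.homEquiv N P :=
    funext fun x => adj.homEquiv_naturality_left f x
  exact h ▸ ((hR.isCUnital_homFunctor_obj P).bijective_comp hf).comp (adj.homEquiv N P).bijective

/-- Locality of P extends 𝟙 along f to g with f ≫ g = 𝟙; locality of Q forces g ≫ f = 𝟙. -/
theorem isIso_of_isCUnital_of_isoModSerre {P Q : NMod R} (hP : isCUnital R P) (hQ : isCUnital R Q)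
    {f : P ⟶ Q} (hf : (isNull R).isoModSerre f) : IsIso f := by
  obtain ⟨g, hg⟩ := (hP.bijective_comp hf).2 (𝟙 P)
  refine ⟨g, hg, (hQ.bijective_comp hf).1 ?_⟩
  change f ≫ g ≫ f = f ≫ 𝟙 Q
  rw [reassoc_of% (show f ≫ g = 𝟙 P from hg), Category.comp_id]

/-- Naturality of ν and two-out-of-three make H f an isomorphism modulo null-modules; its source and
target are c-unital. -/
theorem IsTUnitalRing.isIso_homFunctor_map (hR : IsTUnitalRing R) {P Q : NMod R} {f : P ⟶ Q}
    (hf : (isNull R).isoModSerre f) : IsIso ((homFunctor R).map f) := by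
  refine isIso_of_isCUnital_of_isoModSerre (hR.isCUnital_homFunctor_obj P)
    (hR.isCUnital_homFunctor_obj Q) ?_
  rw [← (isNull R).isoModSerre.precomp_iff _ _ (isoModSerre_homUnitality P)]
  have := (homUnitality R).naturality f
  rw [← this]
  exact (isNull R).isoModSerre.comp_mem _ _ hf (isoModSerre_homUnitality Q)

/-! ### The Serre quotient and its equivalences -/

theorem isAbelianCategory_serreQuotient : IsAbelianCategory (SerreQuotient R) :=
  ⟨ObjectProperty.SerreClassLocalization.abelian (quotientFunctor R) (isNull R), rfl⟩

theorem IsTUnitalRing.isInvertedBy_tensorToT (hR : IsTUnitalRing R) :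
    (isNull R).isoModSerre.IsInvertedBy (tensorToT R hR.isTUnital_tensorFunctor_obj) := by
  intro M N f hf
  have : IsIso ((isTUnital R).ι.map ((tensorToT R hR.isTUnital_tensorFunctor_obj).map f)) :=
    hR.isIso_tensorFunctor_map hf
  exact isIso_of_reflects_iso _ (isTUnital R).ι

theorem IsTUnitalRing.isInvertedBy_homToC (hR : IsTUnitalRing R) :
    (isNull R).isoModSerre.IsInvertedBy (homToC R hR.isCUnital_homFunctor_obj) := by
  intro M N f hf
  have : IsIso ((isCUnital R).ι.map ((homToC R hR.isCUnital_homFunctor_obj).map f)) :=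
    hR.isIso_homFunctor_map hf
  exact isIso_of_reflects_iso _ (isCUnital R).ι

/-- The functor `R ⊗_R -` is isomorphic to the identity on t-unital modules. -/
noncomputable def tensorToTIso (hT : ∀ M, isTUnital R ((tensorFunctor R).obj M)) :
    (isTUnital R).ι ⋙ tensorToT R hT ≅ 𝟭 (TMod R) :=
  NatIso.ofComponents (fun M =>
    haveI : IsIso ((tensorUnitality R).app M.obj) := M.property
    (isTUnital R).isoMk (asIso ((tensorUnitality R).app M.obj)))
    fun f => ObjectProperty.hom_ext _ ((tensorUnitality R).naturality f.hom)

/-- The functor `Hom_R(R, -)` is isomorphic to the identity on c-unital modules. -/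
noncomputable def homToCIso (hC : ∀ P, isCUnital R ((homFunctor R).obj P)) :
    (isCUnital R).ι ⋙ homToC R hC ≅ 𝟭 (CMod R) :=
  (show 𝟭 (CMod R) ≅ (isCUnital R).ι ⋙ homToC R hC from NatIso.ofComponents (fun P =>
    haveI : IsIso ((homUnitality R).app P.obj) := P.property
    (isCUnital R).isoMk (asIso ((homUnitality R).app P.obj)))
    fun f => ObjectProperty.hom_ext _ ((homUnitality R).naturality f.hom)).symm

variable (R) in
/-- The functor `R ⊗_R -` is isomorphic to the identity modulo null-modules. -/
noncomputable def tensorFunctorQuotientIso :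
    tensorFunctor R ⋙ quotientFunctor R ≅ quotientFunctor R :=
  NatIso.ofComponents (fun M =>
    haveI := (isNull R).isoModSerre.Q_inverts _ (isoModSerre_tensorUnitality M)
    asIso ((quotientFunctor R).map ((tensorUnitality R).app M)))
    fun f => by
      simp only [asIso_hom, Functor.comp_map, ← Functor.map_comp]
      exact congrArg _ ((tensorUnitality R).naturality f)

variable (R) in
/-- The functor `Hom_R(R, -)` is isomorphic to the identity modulo null-modules. -/
noncomputable def homFunctorQuotientIso :
    homFunctor R ⋙ quotientFunctor R ≅ quotientFunctor R :=
  (show quotientFunctor R ≅ homFunctor R ⋙ quotientFunctor R from NatIso.ofComponents (fun P =>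
    haveI := (isNull R).isoModSerre.Q_inverts _ (isoModSerre_homUnitality P)
    asIso ((quotientFunctor R).map ((homUnitality R).app P)))
    fun f => by
      simp only [asIso_hom, Functor.comp_map, ← Functor.map_comp]
      exact congrArg _ ((homUnitality R).naturality f)).symm

/-- The equivalence between t-unital modules and the Serre quotient. -/
noncomputable def IsTUnitalRing.tEquivalence (hR : IsTUnitalRing R) : TMod R ≌ SerreQuotient R :=
  localizationEquivalence (tensorToT R hR.isTUnital_tensorFunctor_obj) hR.isInvertedBy_tensorToT
    (tensorToTIso _) (tensorFunctorQuotientIso R)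

/-- The equivalence between c-unital modules and the Serre quotient. -/
noncomputable def IsTUnitalRing.cEquivalence (hR : IsTUnitalRing R) : CMod R ≌ SerreQuotient R :=
  localizationEquivalence (homToC R hR.isCUnital_homFunctor_obj) hR.isInvertedBy_homToC
    (homToCIso _) (homFunctorQuotientIso R)

end Serre

instance homFunctor_additive (R : Type u) [NonUnitalRing R] : (homFunctor R).Additive where
  map_add {P Q f g} := by
    ext h
    exact homR_ext fun r => rfl

end TUnital

theorem corollary5p10 (R : Type u) [NonUnitalRing R] (hR : IsTUnitalRing R) :
    -- null-modules form a Serre subcategory; `R ⊗_R M` is t-unital and `Hom_R(R, P)` is c-unital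
    ∃ (_ : (isNull R).IsSerreClass)
      (hT : ∀ M, isTUnital R ((tensorFunctor R).obj M))
      (hC : ∀ P, isCUnital R ((homFunctor R).obj P)),
      -- the three categories are abelian
      IsAbelianCategory (TMod R) ∧
      IsAbelianCategory (SerreQuotient R) ∧
      IsAbelianCategory (CMod R) ∧
      -- the equivalences with the Serre quotient and the mutually inverse equivalences
      ∃ (eT : TMod R ≌ SerreQuotient R)
        (eC : SerreQuotient R ≌ CMod R)
        (e : TMod R ≌ CMod R),
        eT.functor.Additive ∧ eC.functor.Additive ∧ e.functor.Additive ∧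
        eT.functor = (isTUnital R).ι ⋙ quotientFunctor R ∧
        Nonempty (quotientFunctor R ⋙ eT.inverse ≅ tensorToT R hT) ∧
        eC.inverse = (isCUnital R).ι ⋙ quotientFunctor R ∧
        Nonempty (quotientFunctor R ⋙ eC.functor ≅ homToC R hC) ∧
        e.functor = (isTUnital R).ι ⋙ homToC R hC ∧
        e.inverse = (isCUnital R).ι ⋙ tensorToT R hT ∧
        Nonempty (eT.functor ⋙ eC.functor ≅ e.functor) ∧
        -- the ambidextrous adjunction
        (∃ adj₁ : (isCUnital R).ι ⋙ tensorToT R hT ⊣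
            (isTUnital R).ι ⋙ homToC R hC,
          ∀ (M : TMod R) (r : R) (f : HomR R M.obj),
            (adj₁.counit.app M).hom.hom (tmulR R r f) = f r) ∧
        (∃ adj₂ : (isTUnital R).ι ⋙ homToC R hC ⊣
            (isCUnital R).ι ⋙ tensorToT R hT,
          (∀ M : TMod R,
            (tensorUnitality R).app M.obj ≫ (adj₂.unit.app M).hom =
              (tensorFunctor R).map ((homUnitality R).app M.obj)) ∧
          (∀ P : CMod R,
            (adj₂.counit.app P).hom ≫ (homUnitality R).app P.obj =
              (homFunctor R).map ((tensorUnitality R).app P.obj))) := by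
  have := hR.isSerreClass
  have hT := hR.isTUnital_tensorFunctor_obj
  have hC := hR.isCUnital_homFunctor_obj
  have hμ (M : TMod R) : IsIso ((tensorUnitality R).app M.obj) := M.property
  have hν (P : CMod R) : IsIso ((homUnitality R).app P.obj) := P.property
  let adj := fixedObjectsAdjunction (tensorUnitality R) (homUnitality R) hμ hν hT hC
    tensorFunctor_map_tensorUnitality homFunctor_map_homUnitality
  have hunit (M : TMod R) : (tensorUnitality R).app M.obj ≫ (adj.unit.app M).hom =
      (tensorFunctor R).map ((homUnitality R).app M.obj) :=
    IsIso.hom_inv_id_assoc ((tensorUnitality R).app M.obj) _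
  have hcounit (P : CMod R) : (adj.counit.app P).hom ≫ (homUnitality R).app P.obj =
      (homFunctor R).map ((tensorUnitality R).app P.obj) :=
    (Category.assoc _ _ _).trans ((congrArg _ (IsIso.inv_hom_id _)).trans (Category.comp_id _))
  -- T inverts ν_M, and μ_M is invertible, so `hunit` exhibits the unit as invertible; the counit is
  -- dual.
  have (M : TMod R) : IsIso (adj.unit.app M) := by
    have h := hR.isIso_tensorFunctor_map (isoModSerre_homUnitality M.obj)
    rw [← hunit] at h
    have : IsIso ((isTUnital R).ι.map (adj.unit.app M)) :=
      @IsIso.of_isIso_comp_left _ _ _ _ _ ((tensorUnitality R).app M.obj) _ (hμ M) h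
    exact isIso_of_reflects_iso _ (isTUnital R).ι
  have (P : CMod R) : IsIso (adj.counit.app P) := by
    have h := hR.isIso_homFunctor_map (isoModSerre_tensorUnitality P.obj)
    rw [← hcounit] at h
    have : IsIso ((isCUnital R).ι.map (adj.counit.app P)) :=
      @IsIso.of_isIso_comp_right _ _ _ _ _ _ ((homUnitality R).app P.obj) (hν P) h
    exact isIso_of_reflects_iso _ (isCUnital R).ι
  have : hR.tEquivalence.functor.Additive :=
    inferInstanceAs ((isTUnital R).ι ⋙ quotientFunctor R).Additive
  have : hR.cEquivalence.functor.Additive :=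
    inferInstanceAs ((isCUnital R).ι ⋙ quotientFunctor R).Additive
  -- The inverse equivalences were built as lifts of T and H to the localization.
  let iT : quotientFunctor R ⋙ hR.tEquivalence.inverse ≅ tensorToT R hT := Localization.fac _ _ _
  let iC : quotientFunctor R ⋙ hR.cEquivalence.inverse ≅ homToC R hC := Localization.fac _ _ _
  refine ⟨‹_›, hT, hC, isAbelianCategory_serreQuotient.of_equivalence hR.tEquivalence,
    isAbelianCategory_serreQuotient, isAbelianCategory_serreQuotient.of_equivalence hR.cEquivalence,
    hR.tEquivalence, hR.cEquivalence.symm, adj.toEquivalence, ‹_›,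
    hR.cEquivalence.inverse_additive, ?_, rfl, ⟨iT⟩, rfl, ⟨iC⟩, rfl, rfl,
    ⟨Functor.isoWhiskerLeft (isTUnital R).ι iC⟩,
    ⟨fullSubcategoryAdjunction (tensorHomAdjunction R) hT hC, fun _ _ _ => rfl⟩,
    ⟨adj, hunit, hcounit⟩⟩
  exact { map_add := fun {M N f g} => ObjectProperty.hom_ext _ ((homFunctor R).map_add) }
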